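/- **Theorem.** Let $N$ be a ground set of $n$ elements, let $f:2^N\to\mathbb{R}_{\ge 0}$ be a non-negative (not necessarily monotone) submodular function, accessible only through a value oracle, and let $A\in[0,1]^{m\times n}$ be a matrix with at least one positive entry and $b\in[1,\infty)^m$. Call $S\subseteq N$ feasible if $Ax_S\le b$, where $x_S$ is the characteristic vector of $S$, and let $W=\min\{b_i/A_{ij} : A_{ij}>0\}$ be the width. Write $f(j\mid S)=f(S\cup\{j\})-f(S)$. For $N'\subseteq N$ and $\lambda>0$, the procedure $\mathrm{MU}(N',\lambda)$ starts with $S=\emptyset$ and $w_i=1/b_i$ for $i=1,\dots,m$. While $\sum_i b_iw_i\le\lambda$ and $N'\setminus S\ne\emptyset$, it picks $j\in N'\setminus S$ maximizing $f(j\mid S)/\sum_i A_{ij}w_i$ (ties are broken by an arbitrary fixed rule that depends only on the set of maximizers; $x/0$ is $+\infty$, $0$, $-\infty$ according to the sign of $x$); it leaves the loop if $f(j\mid S)\le 0$, and otherwise adds $j$ to $S$ and multiplies each $w_i$ by $\lambda^{A_{ij}/b_i}$. It returns $S$ if $Ax_S\le b$, and otherwise $S$ without the element added last. Consider the following main algorithm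 with parameter $\epsilon$: compute $S_1=\mathrm{MU}(N,e^{\epsilon W/3})$ and $S_2=\mathrm{MU}(N\setminus S_1,e^{\epsilon W/3})$; run on $S_1$ a deterministic $1/2$-approximation algorithm for unconstrained submodular maximization to obtain $S_1'\subseteq S_1$ with $f(S_1')\ge\frac12 f(T)$ for all $T\subseteq S_1$; return a set of largest value among $S_1,S_2,S_1'$. Here the subroutine is required to be correct for all non-negative submodular functions and to use at most $c(|S|^2+1)$ queries on a ground set $S$, for an absolute constant $c$. Then a subroutine of this kind exists for some $c$. Moreover, for every $c$ there is a constant $C$, depending only on $c$, such that, with any such subroutine, for every $\epsilon>0$ and every instance with $$W\ge\max\{9\ln m/\epsilon^2,\;3/\epsilon\},$$ the main algorithm is deterministic, returns a feasible set $S$ with $f(S)\ge(1/6-\epsilon)\,f(T)$ for every feasible $T\subseteq N$, and makes at most $C n^2$ queries to the value oracle. -/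

import Mathlib

open scoped Matrix

namespace LinearPacking

/-! ### Set functions -/

/-- A set function on the ground set `Fin n` is submodular. -/
def Submodular {n : ℕ} (f : Finset (Fin n) → ℝ) : Prop :=
  ∀ S T, f (S ∪ T) + f (S ∩ T) ≤ f S + f T

/-! ### Deterministic algorithms with a value oracle

The objective `f` is accessible only through a value oracle.  A deterministic algorithm is a
decision tree: it either stops with an output, or queries a set and continues according to the
answer.  Efficiency is measured by the number of queries along the branch that is followed. -/

/-- Deterministic value-oracle algorithms over the ground set `Fin n` with output in `β`. -/
inductive OracleProg (n : ℕ) (β : Type) : Type where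
  | pure : β → OracleProg n β
  | query : Finset (Fin n) → (ℝ → OracleProg n β) → OracleProg n β

namespace OracleProg

variable {n : ℕ} {β γ : Type}

/-- Sequential composition. -/
def bind : OracleProg n β → (β → OracleProg n γ) → OracleProg n γ
  | .pure x, k => k x
  | .query S c, k => .query S (fun v => (c v).bind k)

/-- The output of the algorithm when the oracle is `f`. -/
def run (f : Finset (Fin n) → ℝ) : OracleProg n β → β
  | .pure x => x
  | .query S c => (c (f S)).run f

/-- The number of oracle queries made when the oracle is `f` (repeated queries are counted). -/
def queries (f : Finset (Fin n) → ℝ) : OracleProg n β → ℕ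
  | .pure _ => 0
  | .query S c => (c (f S)).queries f + 1

end OracleProg

/-! ### Linear packing constraints -/

/-- `S` is feasible: `A x_S ≤ b`, with `x_S` the characteristic vector of `S`. -/
def Feasible {m n : ℕ} (A : Matrix (Fin m) (Fin n) ℝ) (b : Fin m → ℝ)
    (S : Finset (Fin n)) : Prop :=
  A *ᵥ (fun j => if j ∈ S then 1 else 0) ≤ b

/-- The width `W = min {b_i / A_ij | A_ij > 0}`.  (It is a minimum whenever `A` has a positive
entry.) -/
noncomputable def width {m n : ℕ} (A : Matrix (Fin m) (Fin n) ℝ) (b : Fin m → ℝ) : ℝ :=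
  sInf {r | ∃ i j, 0 < A i j ∧ r = b i / A i j}

/-! ### The multiplicative updates algorithm -/

/-- The ratio `gain / cost` for `cost ≥ 0`, where `x / 0` is `+∞`, `0`, `-∞` according to the sign
of `x`. -/
noncomputable def ratio (gain cost : ℝ) : EReal :=
  if cost = 0 then (gain : EReal) * ⊤ else ((gain / cost : ℝ) : EReal)

/-- The set of maximizers of `r` over `R`. -/
noncomputable def argmaxSet {n : ℕ} (R : Finset (Fin n)) (r : Fin n → EReal) : Finset (Fin n) :=
  R.filter (fun j => ∀ k ∈ R, r k ≤ r j)

/-- Query `f (S ∪ {j})` for all `j` in a list, and return the table of answers. -/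
noncomputable def queryTable {n : ℕ} (S : Finset (Fin n)) :
    List (Fin n) → OracleProg n (Fin n → ℝ)
  | [] => .pure (fun _ => 0)
  | j :: l => .query (insert j S) (fun v =>
      (queryTable S l).bind (fun g => .pure (Function.update g j v)))

open scoped Classical in
/-- The `while` loop, from the current solution `S`, last added element `last`, and weights `w`;
it returns the final solution and the last element added.  The first explicit argument bounds
the number of remaining rounds; since each round but the last adds a new element of `N`, the bound
`N.card` used below never cuts the loop short.  The function `tb` breaks ties: it selects an
element of the set of maximizers. -/
noncomputable def muLoop {m n : ℕ} (tb : Finset (Fin n) → Fin n)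
    (A : Matrix (Fin m) (Fin n) ℝ) (b : Fin m → ℝ) (lam : ℝ) (N : Finset (Fin n)) :
    ℕ → Finset (Fin n) → Option (Fin n) → (Fin m → ℝ) →
      OracleProg n (Finset (Fin n) × Option (Fin n))
  | 0, S, last, _ => .pure (S, last)
  | k + 1, S, last, w =>
      if ∑ i, b i * w i ≤ lam ∧ (N \ S).Nonempty then
        .query S (fun v =>
          (queryTable S (N \ S).sort).bind (fun g =>
            let gain : Fin n → ℝ := fun j => g j - v
            let j := tb (argmaxSet (N \ S) (fun j => ratio (gain j) (∑ i, A i j * w i)))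
            if gain j ≤ 0 then .pure (S, last)
            else muLoop tb A b lam N k (insert j S) (some j)
              (fun i => w i * lam ^ (A i j / b i))))
      else .pure (S, last)

open scoped Classical in
/-- Multiplicative updates on the ground set `N` with parameter `lam`: start from `S = ∅` and
`w_i = 1 / b_i`, run the loop, and drop the last added element if the result is infeasible. -/
noncomputable def multUpdates {m n : ℕ} (tb : Finset (Fin n) → Fin n)
    (A : Matrix (Fin m) (Fin n) ℝ) (b : Fin m → ℝ) (lam : ℝ) (N : Finset (Fin n)) :
    OracleProg n (Finset (Fin n)) :=
  (muLoop tb A b lam N N.card ∅ none (fun i => 1 / b i)).bind (fun p =>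
    .pure (if Feasible A b p.1 then p.1
      else match p.2 with
        | some j => p.1.erase j
        | none => p.1))

/-! ### Unconstrained submodular maximization -/

/-- `U` is a deterministic `1/2`-approximation algorithm for unconstrained submodular maximization
with quadratic query complexity, with constant `c`.  On input `S` and access to a non-negative
submodular `f`, it returns a subset of `S` whose value is at least half of the value of every
subset of `S`, and it makes at most `c (|S|² + 1)` queries. -/
def IsHalfUSM (c : ℕ) (U : (n : ℕ) → Finset (Fin n) → OracleProg n (Finset (Fin n))) : Prop :=
  ∀ (n : ℕ) (f : Finset (Fin n) → ℝ), (∀ S, 0 ≤ f S) → Submodular f →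
    ∀ S : Finset (Fin n),
      (U n S).run f ⊆ S ∧
      (∀ T ⊆ S, (1 / 2) * f T ≤ f ((U n S).run f)) ∧
      (U n S).queries f ≤ c * (S.card ^ 2 + 1)

/-! ### The main algorithm -/

/-- Query the values of three sets and return one of largest value. -/
noncomputable def bestOfThree {n : ℕ} (S₁ S₂ S₃ : Finset (Fin n)) :
    OracleProg n (Finset (Fin n)) :=
  .query S₁ (fun v₁ => .query S₂ (fun v₂ => .query S₃ (fun v₃ =>
    .pure (if v₂ ≤ v₁ ∧ v₃ ≤ v₁ then S₁ else if v₃ ≤ v₂ then S₂ else S₃))))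

/-- The main algorithm: multiplicative updates on `N` give `S₁`, multiplicative updates on
`N \ S₁` give `S₂`, unconstrained submodular maximization over `S₁` gives `S₁'`; the best of the
three sets is returned.  Both runs use the parameter `e^{ε W / 3}`. -/
noncomputable def mainAlg {m n : ℕ}
    (U : (n : ℕ) → Finset (Fin n) → OracleProg n (Finset (Fin n)))
    (tb : Finset (Fin n) → Fin n)
    (A : Matrix (Fin m) (Fin n) ℝ) (b : Fin m → ℝ) (ε : ℝ) : OracleProg n (Finset (Fin n)) :=
  (multUpdates tb A b (Real.exp (ε * width A b / 3)) Finset.univ).bind (fun S₁ =>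
    (multUpdates tb A b (Real.exp (ε * width A b / 3)) (Finset.univ \ S₁)).bind (fun S₂ =>
      (U n S₁).bind (fun S₁' => bestOfThree S₁ S₂ S₁')))

end LinearPacking

/-! Put `L = εW/3` and `δ = ε/3`. The weights depend only on the current set `S`: `w_i = exp(L ·
load_i / b_i) / b_i`. The potential `Φ(S) = ∑ b_i w_i` starts at `m`, and adding `j` raises `log Φ`
by at most `L κ cost_j / Φ`, since every exponent increment is at most `δ`. The costs of a feasible
`C` sum to at most `Φ`, so the greedy choice pays for this rise: the guarantee `(f(S ∪ C) - f S)(log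
Φ(S) - log m) ≤ L κ f S` accumulates along the loop (`HasGuarantee.insert`). Either no element
improves the final set, or `log Φ ≥ L - δ`; the width assumption makes `log m` and `δ` negligible
against `L`, so `f(S ∪ C)` is at most about `2 f S` (`multUpdates_approx`).

Without monotonicity `f(S ∪ C)` may be far below `f C`. Since `S₁` and `S₂` are disjoint,
`Submodular.le_add_add` bounds `f C` by `f(S₁ ∪ C) + f(S₂ ∪ (C \ S₁)) + f(C ∩ S₁)`. Each term is at
most about twice the returned value, whence `1/6`.

The unconstrained subroutine is double greedy, derandomized by carrying an explicit distribution
over pairs `(X, Y)`. A step needs only two linear inequalities in expectation, so all but two of its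
choices can be made integral. The support therefore grows by at most two per step, and the query
count is quadratic. -/

namespace LinearPacking

/-! ### Output and query count of composed oracle programs -/

namespace OracleProg

variable {n : ℕ} {β γ : Type}

@[simp] theorem run_pure (f : Finset (Fin n) → ℝ) (x : β) :
    (OracleProg.pure x : OracleProg n β).run f = x := rfl

@[simp] theorem run_query (f : Finset (Fin n) → ℝ) (S : Finset (Fin n))
    (c : ℝ → OracleProg n β) : (OracleProg.query S c).run f = (c (f S)).run f := rfl

@[simp] theorem queries_pure (f : Finset (Fin n) → ℝ) (x : β) :
    (OracleProg.pure x : OracleProg n β).queries f = 0 := rfl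

@[simp] theorem queries_query (f : Finset (Fin n) → ℝ) (S : Finset (Fin n))
    (c : ℝ → OracleProg n β) :
    (OracleProg.query S c).queries f = (c (f S)).queries f + 1 := rfl

@[simp] theorem run_bind (f : Finset (Fin n) → ℝ) (P : OracleProg n β)
    (k : β → OracleProg n γ) : (P.bind k).run f = (k (P.run f)).run f := by
  induction P with
  | pure x => rfl
  | query S c ih => exact ih _

@[simp] theorem queries_bind (f : Finset (Fin n) → ℝ) (P : OracleProg n β)
    (k : β → OracleProg n γ) :
    (P.bind k).queries f = P.queries f + (k (P.run f)).queries f := by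
  induction P with
  | pure x => simp [bind, run]
  | query S c ih => simp only [bind, queries, run, ih]; omega

end OracleProg

/-! ### Submodular functions -/

theorem Submodular.marginal_anti {n : ℕ} {f : Finset (Fin n) → ℝ} (hf : Submodular f)
    {X Y : Finset (Fin n)} (hXY : X ⊆ Y) {u : Fin n} (hu : u ∉ Y) :
    f (insert u Y) - f Y ≤ f (insert u X) - f X := by
  have h := hf (insert u X) Y
  have h1 : insert u X ∪ Y = insert u Y := by
    rw [Finset.insert_union, Finset.union_eq_right.2 hXY]
  have h2 : insert u X ∩ Y = X := by
    rw [Finset.insert_inter_of_notMem hu, Finset.inter_eq_left.2 hXY]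
  rw [h1, h2] at h
  linarith

/-- This is the sign condition that double greedy needs: inserting `u` into `X` and deleting it from
`Y` cannot both lose on balance. -/
theorem Submodular.marginal_add_nonneg {n : ℕ} {f : Finset (Fin n) → ℝ} (hf : Submodular f)
    {X Y : Finset (Fin n)} (hXY : X ⊆ Y) {u : Fin n} (hu : u ∈ Y) (hu' : u ∉ X) :
    0 ≤ (f (insert u X) - f X) + (f (Y.erase u) - f Y) := by
  have h := hf.marginal_anti (X := X) (Y := Y.erase u) (u := u)
    (fun x hx => Finset.mem_erase.2 ⟨fun e => hu' (e ▸ hx), hXY hx⟩) (Finset.notMem_erase _ _)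
  rw [Finset.insert_erase hu] at h
  linarith

theorem Submodular.union_sub_le_sum {n : ℕ} {f : Finset (Fin n) → ℝ} (hf : Submodular f)
    (S C : Finset (Fin n)) :
    f (S ∪ C) - f S ≤ ∑ k ∈ C \ S, (f (insert k S) - f S) := by
  have key : ∀ D : Finset (Fin n), Disjoint D S →
      f (S ∪ D) - f S ≤ ∑ k ∈ D, (f (insert k S) - f S) := by
    intro D
    induction D using Finset.induction_on with
    | empty => simp
    | insert a D ha ih =>
      intro hd
      rw [Finset.disjoint_insert_left] at hd
      rw [Finset.sum_insert ha, Finset.union_insert]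
      have h1 := ih hd.2
      have h2 := hf.marginal_anti (X := S) (Y := S ∪ D) (u := a) Finset.subset_union_left
        (by simp [hd.1, ha])
      linarith
  have h := key (C \ S) Finset.sdiff_disjoint
  rwa [Finset.union_sdiff_self_eq_union] at h

/-! ### Rounding all but two coordinates of a fractional solution -/

/-- A point of the unit cube can be moved, without changing the values of two linear functionals,
to a point of the cube with at most two fractional coordinates. -/
theorem exists_round_all_but_two {ι : Type*} [Fintype ι] (α β z : ι → ℝ)
    (hz : ∀ k, 0 ≤ z k ∧ z k ≤ 1) :
    ∃ z' : ι → ℝ, (∀ k, 0 ≤ z' k ∧ z' k ≤ 1) ∧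
      ∑ k, α k * z' k = ∑ k, α k * z k ∧ ∑ k, β k * z' k = ∑ k, β k * z k ∧
      (Finset.univ.filter (fun k => z' k ≠ 0 ∧ z' k ≠ 1)).card ≤ 2 := by
  classical
  induction hN : (Finset.univ.filter (fun k => z k ≠ 0 ∧ z k ≠ 1)).card
    using Nat.strong_induction_on generalizing z with
  | _ N ih =>
  set t := Finset.univ.filter (fun k => z k ≠ 0 ∧ z k ≠ 1) with ht
  by_cases hc : N ≤ 2
  · exact ⟨z, hz, rfl, rfl, by rw [← ht]; omega⟩
  have hfr : ∀ k, k ∈ t → 0 < z k ∧ z k < 1 := by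
    intro k hk
    have hk' := (Finset.mem_filter.1 hk).2
    exact ⟨lt_of_le_of_ne (hz k).1 (Ne.symm hk'.1), lt_of_le_of_ne (hz k).2 hk'.2⟩
  -- Three or more fractional coordinates give vectors `(α k, β k)` that are dependent in the plane,
  -- hence a direction `d` along which both functionals are constant.
  obtain ⟨d, hdsum, k₁, hk₁⟩ : ∃ d : ι → ℝ,
      (∑ k ∈ t, d k * α k = 0 ∧ ∑ k ∈ t, d k * β k = 0) ∧ ∃ k ∈ t, d k ≠ 0 := by
    have hrank : Module.finrank ℝ (ℝ × ℝ) < Fintype.card t := by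
      rw [Fintype.card_coe, Module.finrank_prod, Module.finrank_self]
      omega
    have hdep : ¬ LinearIndependent ℝ (fun k : t => (α k, β k)) := fun hli =>
      absurd hli.fintype_card_le_finrank (not_le.2 hrank)
    obtain ⟨g, hg, i, hi⟩ := Fintype.not_linearIndependent_iff.1 hdep
    refine ⟨fun k => if h : k ∈ t then g ⟨k, h⟩ else 0, ⟨?_, ?_⟩, i, i.2, by simpa using hi⟩
    · rw [← Finset.sum_coe_sort t]
      simpa [Prod.fst_sum] using congrArg Prod.fst hg
    · rw [← Finset.sum_coe_sort t]
      simpa [Prod.snd_sum] using congrArg Prod.snd hg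
  -- `r k` is the step length along `d` at which coordinate `k` reaches the boundary; the smallest
  -- one makes a new coordinate integral and keeps the others in the unit interval.
  let r : ι → ℝ := fun k => if 0 < d k then (1 - z k) / d k else z k / (-d k)
  obtain ⟨k₀, hk₀, hmin⟩ := (t.filter (fun k => d k ≠ 0)).exists_min_image r
    ⟨k₁, Finset.mem_filter.2 hk₁⟩
  have hk₀t := (Finset.mem_filter.1 hk₀).1
  have hd₀ := (Finset.mem_filter.1 hk₀).2
  have hr₀ : 0 ≤ r k₀ := by
    have := hfr k₀ hk₀t
    simp only [r]
    split_ifs with h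
    · exact div_nonneg (by linarith) h.le
    · exact div_nonneg (by linarith) (by linarith [not_lt.1 h])
  set y : ι → ℝ := fun k => if k ∈ t then z k + r k₀ * d k else z k with hy
  have hy01 : ∀ k, 0 ≤ y k ∧ y k ≤ 1 := by
    intro k
    simp only [hy]
    split_ifs with hkt
    · have hzk := hfr k hkt
      rcases lt_trichotomy (d k) 0 with h | h | h
      · have hm := hmin k (Finset.mem_filter.2 ⟨hkt, h.ne⟩)
        simp only [r, if_neg (not_lt.2 h.le)] at hm
        change r k₀ ≤ _ at hm
        rw [le_div_iff₀ (by linarith)] at hm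
        constructor
        · linarith
        · nlinarith
      · rw [h]; constructor <;> linarith
      · have hm := hmin k (Finset.mem_filter.2 ⟨hkt, h.ne'⟩)
        simp only [r, if_pos h] at hm
        change r k₀ ≤ _ at hm
        rw [le_div_iff₀ h] at hm
        constructor
        · nlinarith
        · linarith
    · exact hz k
  have hy₀ : y k₀ = 0 ∨ y k₀ = 1 := by
    simp only [hy, if_pos hk₀t, r]
    split_ifs with h
    · right; field_simp; ring
    · left
      have : d k₀ ≠ 0 := hd₀
      field_simp; ring
  have hsum : ∀ γ : ι → ℝ, ∑ k ∈ t, d k * γ k = 0 → ∑ k, γ k * y k = ∑ k, γ k * z k := by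
    intro γ hγ
    have e : ∀ k, γ k * y k = γ k * z k + r k₀ * (if k ∈ t then d k * γ k else 0) := by
      intro k
      simp only [hy]
      split_ifs <;> ring
    simp_rw [e]
    rw [Finset.sum_add_distrib, ← Finset.mul_sum, ← Finset.sum_filter, Finset.filter_mem_eq_inter,
      Finset.univ_inter, hγ]
    ring
  have hlt : (Finset.univ.filter (fun k => y k ≠ 0 ∧ y k ≠ 1)).card < N := by
    rw [← hN]
    apply Finset.card_lt_card
    rw [Finset.ssubset_iff_of_subset]
    · refine ⟨k₀, hk₀t, fun h => ?_⟩
      have h' := (Finset.mem_filter.1 h).2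
      rcases hy₀ with h0 | h1
      · exact h'.1 h0
      · exact h'.2 h1
    · intro k hk
      by_contra hkt
      have h' := (Finset.mem_filter.1 hk).2
      simp only [hy, if_neg hkt] at h'
      exact hkt (Finset.mem_filter.2 ⟨Finset.mem_univ _, h'⟩)
  obtain ⟨z', h1, h2, h3, h4⟩ := ih _ hlt y hy01 rfl
  exact ⟨z', h1, h2.trans (hsum α hdsum.1), h3.trans (hsum β hdsum.2), h4⟩

/-- The fractional choices of one step of double greedy, with at most two fractional entries. -/
theorem exists_doubleGreedy_choice {ι : Type*} [Fintype ι] (p a b : ι → ℝ) (hp : ∀ k, 0 ≤ p k)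
    (hab : ∀ k, 0 ≤ a k + b k) :
    ∃ z : ι → ℝ, (∀ k, 0 ≤ z k ∧ z k ≤ 1) ∧
      2 * ∑ k, p k * (z k * b k) ≤ ∑ k, p k * (z k * a k + (1 - z k) * b k) ∧
      2 * ∑ k, p k * ((1 - z k) * a k) ≤ ∑ k, p k * (z k * a k + (1 - z k) * b k) ∧
      (Finset.univ.filter (fun k => z k ≠ 0 ∧ z k ≠ 1)).card ≤ 2 := by
  -- Randomized double greedy handles each pair separately: `z = a / (a + b)` when both gains are
  -- positive, otherwise a deterministic choice.
  have hex : ∀ k, ∃ z : ℝ, (0 ≤ z ∧ z ≤ 1) ∧ 2 * (z * b k) ≤ z * a k + (1 - z) * b k ∧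
      2 * ((1 - z) * a k) ≤ z * a k + (1 - z) * b k := by
    intro k
    have h := hab k
    by_cases hb : b k ≤ 0
    · exact ⟨1, by norm_num, by linarith, by linarith⟩
    by_cases ha : a k ≤ 0
    · exact ⟨0, by norm_num, by linarith, by linarith⟩
    push Not at ha hb
    have hs : 0 < a k + b k := by linarith
    have e1 : a k / (a k + b k) * (a k + b k) = a k := div_mul_cancel₀ _ hs.ne'
    set z := a k / (a k + b k) with hz
    have hz0 : 0 ≤ z := div_nonneg ha.le hs.le
    have hz1 : z ≤ 1 := (div_le_one hs).2 (by linarith)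
    have e2 : (1 - z) * a k = z * b k := by linarith
    have e3 : z * a k + (1 - z) * b k - 2 * (z * b k) = (a k - b k) ^ 2 / (a k + b k) := by
      rw [hz]; field_simp; ring
    have e4 : 0 ≤ (a k - b k) ^ 2 / (a k + b k) := by positivity
    exact ⟨z, ⟨hz0, hz1⟩, by linarith, by linarith⟩
  choose z hz h1 h2 using hex
  -- Both inequalities are affine in `z`; these are their linear coefficients, so preserving the two
  -- functionals preserves the inequalities.
  obtain ⟨y, hy, hα, hβ, hc⟩ := exists_round_all_but_two
    (fun k => p k * (a k - 3 * b k)) (fun k => p k * (3 * a k - b k)) z hz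
  have hs1 : 0 ≤ ∑ k, (p k * (a k - 3 * b k) * z k + p k * b k) :=
    Finset.sum_nonneg fun k _ => by nlinarith [mul_le_mul_of_nonneg_left (h1 k) (hp k)]
  have hs2 : 0 ≤ ∑ k, (p k * (3 * a k - b k) * z k + p k * (b k - 2 * a k)) :=
    Finset.sum_nonneg fun k _ => by nlinarith [mul_le_mul_of_nonneg_left (h2 k) (hp k)]
  rw [Finset.sum_add_distrib, ← hα, ← Finset.sum_add_distrib] at hs1
  rw [Finset.sum_add_distrib, ← hβ, ← Finset.sum_add_distrib] at hs2
  refine ⟨y, hy, ?_, ?_, hc⟩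
  · rw [← sub_nonneg, Finset.mul_sum, ← Finset.sum_sub_distrib]
    exact hs1.trans_eq (Finset.sum_congr rfl fun k _ => by ring)
  · rw [← sub_nonneg, Finset.mul_sum, ← Finset.sum_sub_distrib]
    exact hs2.trans_eq (Finset.sum_congr rfl fun k _ => by ring)

/-! ### Deterministic double greedy -/

/-- Query the values of all sets in a list, and return the table of answers. -/
noncomputable def queryValues {n : ℕ} :
    List (Finset (Fin n)) → OracleProg n (Finset (Fin n) → ℝ)
  | [] => .pure (fun _ => 0)
  | S :: l => .query S (fun v =>
      (queryValues l).bind (fun g => .pure (Function.update g S v)))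

theorem run_queryValues {n : ℕ} (f : Finset (Fin n) → ℝ) (l : List (Finset (Fin n))) :
    ∀ S ∈ l, (queryValues l).run f S = f S := by
  induction l with
  | nil => simp
  | cons T l ih =>
    intro S hS
    simp only [queryValues, OracleProg.run_query, OracleProg.run_bind, OracleProg.run_pure]
    by_cases h : S = T
    · subst h; simp
    · rw [Function.update_of_ne h]
      exact ih S (by simpa [h] using hS)

theorem queries_queryValues {n : ℕ} (f : Finset (Fin n) → ℝ) (l : List (Finset (Fin n))) :
    (queryValues l).queries f = l.length := by
  induction l with
  | nil => rfl
  | cons T l ih => simp [queryValues, ih]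

/-- An entry of a finitely supported distribution over pairs of sets: a probability and a pair. -/
abbrev WeightedPair (n : ℕ) : Type := ℝ × Finset (Fin n) × Finset (Fin n)

/-- The expectation of `F` under a distribution given by a list of weighted pairs. -/
noncomputable def expect {n : ℕ} (D : List (WeightedPair n))
    (F : Finset (Fin n) → Finset (Fin n) → ℝ) : ℝ :=
  (D.map (fun d => d.1 * F d.2.1 d.2.2)).sum

theorem expect_mono {n : ℕ} {D : List (WeightedPair n)} {F G : Finset (Fin n) → Finset (Fin n) → ℝ}
    (h : ∀ d ∈ D, 0 ≤ d.1 ∧ F d.2.1 d.2.2 ≤ G d.2.1 d.2.2) : expect D F ≤ expect D G :=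
  List.sum_le_sum fun d hd => mul_le_mul_of_nonneg_left (h d hd).2 (h d hd).1

theorem expect_flatMap {n : ℕ} {α : Type*} (l : List α) (g : α → List (WeightedPair n))
    (F : Finset (Fin n) → Finset (Fin n) → ℝ) :
    expect (l.flatMap g) F = (l.map (fun x => expect (g x) F)).sum := by
  induction l with
  | nil => simp [expect]
  | cons a l ih =>
    simp only [expect, List.flatMap_cons, List.map_append, List.sum_append, List.map_cons,
      List.sum_cons] at ih ⊢
    rw [ih]

/-- `D'` is a valid successor of `D` when double greedy decides about `u` with value table `g`. -/
structure IsGreedySucc {n : ℕ} (u : Fin n) (D : List (WeightedPair n)) (g : Finset (Fin n) → ℝ)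
    (D' : List (WeightedPair n)) : Prop where
  length_le : D'.length ≤ D.length + 2
  mem : ∀ d' ∈ D', 0 ≤ d'.1 ∧ ∃ d ∈ D,
    d'.2 = (insert u d.2.1, d.2.2) ∨ d'.2 = (d.2.1, d.2.2.erase u)
  choice : ∃ z : Fin D.length → ℝ, (∀ k, 0 ≤ z k ∧ z k ≤ 1) ∧
    (∀ F : Finset (Fin n) → Finset (Fin n) → ℝ, expect D' F =
      ∑ k, (D.get k).1 * (z k * F (insert u (D.get k).2.1) (D.get k).2.2 +
        (1 - z k) * F (D.get k).2.1 ((D.get k).2.2.erase u))) ∧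
    2 * ∑ k, (D.get k).1 * (z k * (g ((D.get k).2.2.erase u) - g (D.get k).2.2)) ≤
      ∑ k, (D.get k).1 * (z k * (g (insert u (D.get k).2.1) - g (D.get k).2.1) +
        (1 - z k) * (g ((D.get k).2.2.erase u) - g (D.get k).2.2)) ∧
    2 * ∑ k, (D.get k).1 * ((1 - z k) * (g (insert u (D.get k).2.1) - g (D.get k).2.1)) ≤
      ∑ k, (D.get k).1 * (z k * (g (insert u (D.get k).2.1) - g (D.get k).2.1) +
        (1 - z k) * (g ((D.get k).2.2.erase u) - g (D.get k).2.2))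

/-- A pair is split in two only when its `z` is fractional, which happens at most twice; the other
pairs continue along a single branch. -/
theorem exists_isGreedySucc {n : ℕ} (u : Fin n) (D : List (WeightedPair n))
    (g : Finset (Fin n) → ℝ) (hp : ∀ d ∈ D, 0 ≤ d.1)
    (hab : ∀ d ∈ D, 0 ≤ (g (insert u d.2.1) - g d.2.1) + (g (d.2.2.erase u) - g d.2.2)) :
    ∃ D', IsGreedySucc u D g D' := by
  classical
  obtain ⟨z, hz, h1, h2, hc⟩ := exists_doubleGreedy_choice (ι := Fin D.length)
    (fun k => (D.get k).1) (fun k => g (insert u (D.get k).2.1) - g (D.get k).2.1)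
    (fun k => g ((D.get k).2.2.erase u) - g (D.get k).2.2)
    (fun k => hp _ (D.get_mem k)) (fun k => hab _ (D.get_mem k))
  let piece : Fin D.length → List (WeightedPair n) := fun k =>
    if z k = 0 then [((D.get k).1, (D.get k).2.1, (D.get k).2.2.erase u)]
    else if z k = 1 then [((D.get k).1, insert u (D.get k).2.1, (D.get k).2.2)]
    else [((D.get k).1 * z k, insert u (D.get k).2.1, (D.get k).2.2),
      ((D.get k).1 * (1 - z k), (D.get k).2.1, (D.get k).2.2.erase u)]
  refine ⟨(List.finRange D.length).flatMap piece, ?_, ?_, z, hz, ?_, h1, h2⟩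
  · have hl : ∀ k, (piece k).length = 1 + if z k ≠ 0 ∧ z k ≠ 1 then 1 else 0 := by
      intro k
      simp only [piece]
      split_ifs <;> simp_all
    rw [List.length_flatMap, ← Fin.sum_univ_def]
    simp_rw [hl]
    rw [Finset.sum_add_distrib, ← Finset.card_filter]
    simpa using hc
  · intro d' hd'
    obtain ⟨k, -, hk⟩ := List.mem_flatMap.1 hd'
    have hpk := hp _ (D.get_mem k)
    have hzk := hz k
    simp only [piece] at hk
    split_ifs at hk
    · simp only [List.mem_singleton] at hk
      subst hk
      exact ⟨hpk, _, D.get_mem k, Or.inr rfl⟩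
    · simp only [List.mem_singleton] at hk
      subst hk
      exact ⟨hpk, _, D.get_mem k, Or.inl rfl⟩
    · simp only [List.mem_cons, List.not_mem_nil, or_false] at hk
      rcases hk with hk | hk <;> subst hk
      · exact ⟨mul_nonneg hpk hzk.1, _, D.get_mem k, Or.inl rfl⟩
      · exact ⟨mul_nonneg hpk (by linarith), _, D.get_mem k, Or.inr rfl⟩
  · intro F
    rw [expect_flatMap, Fin.sum_univ_def]
    congr 1
    refine List.map_congr_left fun k _ => ?_
    simp only [piece]
    split_ifs with h0 h1
    · simp [expect, h0]
    · simp [expect, h1]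
    · simp only [expect, List.map_cons, List.map_nil, List.sum_cons, List.sum_nil]
      ring

open scoped Classical in
/-- One step of double greedy, deciding about `u` by means of the table `g`. -/
noncomputable def greedySucc {n : ℕ} (u : Fin n) (D : List (WeightedPair n))
    (g : Finset (Fin n) → ℝ) : List (WeightedPair n) :=
  -- The fallback `D` is not reached from a valid state with correct values. The choice depends on
  -- `f` only through the table `g`, so the procedure is a legitimate oracle algorithm.
  if h : ∃ D', IsGreedySucc u D g D' then h.choose else D

/-- The sets whose values are needed to decide about `u`. -/
def greedySets {n : ℕ} (u : Fin n) (D : List (WeightedPair n)) : List (Finset (Fin n)) :=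
  D.flatMap (fun d => [d.2.1, insert u d.2.1, d.2.2, d.2.2.erase u])

/-- Deterministic double greedy: decide about the elements of a list, starting from a distribution
over pairs of sets; finally return the best set in the support. -/
noncomputable def doubleGreedy {n : ℕ} :
    List (Fin n) → List (WeightedPair n) → OracleProg n (Finset (Fin n))
  | [], D => (queryValues (D.map (fun d => d.2.1))).bind (fun g =>
      .pure ((List.argmax g (D.map (fun d => d.2.1))).getD ∅))
  | u :: l, D => (queryValues (greedySets u D)).bind (fun g =>
      doubleGreedy l (greedySucc u D g))

theorem length_greedySets {n : ℕ} (u : Fin n) (D : List (WeightedPair n)) :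
    (greedySets u D).length = 4 * D.length := by
  simp [greedySets, List.length_flatMap, mul_comm]

/-- The sets still undecided, `Y \ X`, are those in `l`, for all pairs in `D`. -/
structure IsGreedyState {n : ℕ} (S : Finset (Fin n)) (l : List (Fin n))
    (D : List (WeightedPair n)) : Prop where
  nonneg : ∀ d ∈ D, 0 ≤ d.1
  sub : ∀ d ∈ D, d.2.1 ⊆ d.2.2 ∧ d.2.2 ⊆ S
  undecided : ∀ d ∈ D, ∀ v, v ∈ l ↔ v ∈ d.2.2 ∧ v ∉ d.2.1
  total : expect D (fun _ _ => 1) = 1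

theorem IsGreedyState.succ {n : ℕ} {S : Finset (Fin n)} {u : Fin n} {l : List (Fin n)}
    {D D' : List (WeightedPair n)} {g : Finset (Fin n) → ℝ} (hul : u ∉ l)
    (hD : IsGreedyState S (u :: l) D) (h : IsGreedySucc u D g D') : IsGreedyState S l D' := by
  refine ⟨fun d' hd' => (h.mem d' hd').1, ?_, ?_, ?_⟩
  · intro d' hd'
    obtain ⟨-, d, hd, e | e⟩ := h.mem d' hd' <;> rw [e]
    · have hu := ((hD.undecided d hd u).1 (by simp))
      exact ⟨Finset.insert_subset hu.1 (hD.sub d hd).1, (hD.sub d hd).2⟩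
    · have hu := ((hD.undecided d hd u).1 (by simp))
      exact ⟨fun x hx => Finset.mem_erase.2 ⟨fun e => hu.2 (e ▸ hx), (hD.sub d hd).1 hx⟩,
        (Finset.erase_subset _ _).trans (hD.sub d hd).2⟩
  · intro d' hd' v
    obtain ⟨-, d, hd, e | e⟩ := h.mem d' hd' <;> rw [e] <;>
      · have hv := hD.undecided d hd v
        rw [List.mem_cons] at hv
        by_cases hvu : v = u
        · subst hvu; simp [hul]
        · simp only [hvu, false_or] at hv
          simp [hv, hvu]
  · obtain ⟨z, -, hF, -⟩ := h.choice
    refine Eq.trans ?_ hD.total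
    rw [hF, expect, ← Fin.sum_univ_fun_getElem]
    exact Finset.sum_congr rfl fun k _ => by simp

/-- The potential of the analysis of double greedy does not decrease. -/
theorem IsGreedySucc.potential_le {n : ℕ} {f : Finset (Fin n) → ℝ} (hf : Submodular f)
    {S : Finset (Fin n)} {u : Fin n} {l : List (Fin n)}
    {D D' : List (WeightedPair n)} {g : Finset (Fin n) → ℝ}
    (hD : IsGreedyState S (u :: l) D) (h : IsGreedySucc u D g D')
    (hg : ∀ T ∈ greedySets u D, g T = f T) (O : Finset (Fin n)) :
    expect D (fun X Y => f ((O ∪ X) ∩ Y) + (f X + f Y) / 2) ≤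
      expect D' (fun X Y => f ((O ∪ X) ∩ Y) + (f X + f Y) / 2) := by
  obtain ⟨z, hz, hF, h1, h2⟩ := h.choice
  have hgf : ∀ k : Fin D.length, g (D.get k).2.1 = f (D.get k).2.1 ∧
      g (insert u (D.get k).2.1) = f (insert u (D.get k).2.1) ∧
      g (D.get k).2.2 = f (D.get k).2.2 ∧
      g ((D.get k).2.2.erase u) = f ((D.get k).2.2.erase u) := by
    intro k
    refine ⟨hg _ ?_, hg _ ?_, hg _ ?_, hg _ ?_⟩ <;>
      exact List.mem_flatMap.2 ⟨_, D.get_mem k, by simp⟩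
  simp_rw [fun k => (hgf k).1, fun k => (hgf k).2.1, fun k => (hgf k).2.2.1,
    fun k => (hgf k).2.2.2] at h1 h2
  have hp : ∀ k, 0 ≤ (D.get k).1 := fun k => hD.nonneg _ (D.get_mem k)
  have hexp : ∀ F : Finset (Fin n) → Finset (Fin n) → ℝ,
      expect D F = ∑ k, (D.get k).1 * F (D.get k).2.1 (D.get k).2.2 := by
    intro F
    rw [expect, ← Fin.sum_univ_fun_getElem]
    rfl
  rw [hF, hexp, ← sub_nonneg, ← Finset.sum_sub_distrib]
  have hmem : ∀ k : Fin D.length, (D.get k).2.1 ⊆ (D.get k).2.2 ∧ u ∈ (D.get k).2.2 ∧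
      u ∉ (D.get k).2.1 := fun k =>
    ⟨(hD.sub _ (D.get_mem k)).1, (hD.undecided _ (D.get_mem k) u).1 (by simp)⟩
  -- If `u ∈ O`, only deleting `u` changes `(O ∪ X) ∩ Y`, and by submodularity the loss is at most
  -- the gain of inserting `u` into `X`. Otherwise only inserting matters, with loss at most the
  -- gain of deleting `u` from `Y`. The two choice inequalities bound the expected loss by the
  -- growth of `(f X + f Y) / 2`.
  by_cases hu : u ∈ O
  · rw [← sub_nonneg, Finset.mul_sum, ← Finset.sum_sub_distrib] at h2
    refine (div_nonneg h2 (by norm_num : (0 : ℝ) ≤ 2)).trans ?_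
    rw [Finset.sum_div]
    refine Finset.sum_le_sum fun k _ => ?_
    obtain ⟨hXY, huY, huX⟩ := hmem k
    have hpk := mul_nonneg (hp k) (sub_nonneg.2 (hz k).2)
    generalize D.get k = d at *
    obtain ⟨p, X, Y⟩ := d
    dsimp only at *
    have e1 : (O ∪ insert u X) ∩ Y = (O ∪ X) ∩ Y := by
      rw [Finset.union_insert, Finset.insert_eq_of_mem (Finset.mem_union_left _ hu)]
    have e2 : (O ∪ X) ∩ Y.erase u = ((O ∪ X) ∩ Y).erase u := Finset.inter_erase _ _ _
    have hm := hf.marginal_anti (X := X) (Y := ((O ∪ X) ∩ Y).erase u) (u := u)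
      (fun x hx => Finset.mem_erase.2 ⟨fun e => huX (e ▸ hx),
        Finset.mem_inter.2 ⟨Finset.mem_union_right _ hx, hXY hx⟩⟩) (Finset.notMem_erase _ _)
    rw [Finset.insert_erase (Finset.mem_inter.2 ⟨Finset.mem_union_left _ hu, huY⟩)] at hm
    rw [e1, e2]
    have := mul_le_mul_of_nonneg_left hm hpk
    linarith
  · rw [← sub_nonneg, Finset.mul_sum, ← Finset.sum_sub_distrib] at h1
    refine (div_nonneg h1 (by norm_num : (0 : ℝ) ≤ 2)).trans ?_
    rw [Finset.sum_div]
    refine Finset.sum_le_sum fun k _ => ?_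
    obtain ⟨hXY, huY, huX⟩ := hmem k
    have hpk := mul_nonneg (hp k) (hz k).1
    generalize D.get k = d at *
    obtain ⟨p, X, Y⟩ := d
    dsimp only at *
    have hu' : u ∉ (O ∪ X) ∩ Y := by simp [hu, huX]
    have e1 : (O ∪ insert u X) ∩ Y = insert u ((O ∪ X) ∩ Y) := by
      rw [Finset.union_insert, Finset.insert_inter_of_mem huY]
    have e2 : (O ∪ X) ∩ Y.erase u = (O ∪ X) ∩ Y := by
      rw [Finset.inter_erase, Finset.erase_eq_of_notMem hu']
    have hm := hf.marginal_anti (X := (O ∪ X) ∩ Y) (Y := Y.erase u) (u := u)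
      (fun x hx => Finset.mem_erase.2 ⟨fun e => hu' (e ▸ hx), (Finset.mem_inter.1 hx).2⟩)
      (Finset.notMem_erase _ _)
    rw [Finset.insert_erase huY] at hm
    rw [e1, e2]
    have := mul_le_mul_of_nonneg_left hm hpk
    linarith

/-- When nothing is undecided, `X = Y` and the potential is an average of `2 f X`, so the best set
in the support dominates it. A round costs four queries per pair and adds at most two pairs, which
sums to the stated bound. -/
theorem doubleGreedy_spec {n : ℕ} {f : Finset (Fin n) → ℝ} (hf : Submodular f)
    (S : Finset (Fin n)) (l : List (Fin n)) (hl : l.Nodup) (D : List (WeightedPair n))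
    (hD : IsGreedyState S l D) :
    (doubleGreedy l D).run f ⊆ S ∧
    (∀ O, expect D (fun X Y => f ((O ∪ X) ∩ Y) + (f X + f Y) / 2) ≤
      2 * f ((doubleGreedy l D).run f)) ∧
    (doubleGreedy l D).queries f ≤ 4 * D.length * l.length + 4 * l.length ^ 2 + D.length := by
  induction l generalizing D with
  | nil =>
    simp only [doubleGreedy, OracleProg.run_bind, OracleProg.run_pure, OracleProg.queries_bind,
      OracleProg.queries_pure, queries_queryValues]
    have hne : D ≠ [] := by
      rintro rfl
      simpa [expect] using hD.total
    set L := D.map (fun d => d.2.1) with hL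
    set g := (queryValues L).run f with hg
    have hgf : ∀ T ∈ L, g T = f T := run_queryValues f L
    obtain ⟨Z, hZ⟩ : ∃ Z, List.argmax g L = some Z := by
      rw [← Option.ne_none_iff_exists', Ne, List.argmax_eq_none]
      simpa [hL] using hne
    have hZL : Z ∈ L := List.argmax_mem hZ
    rw [hZ, Option.getD_some]
    refine ⟨?_, ?_, by simp [hL]⟩
    · obtain ⟨d, hd, rfl⟩ := List.mem_map.1 hZL
      exact (hD.sub d hd).1.trans (hD.sub d hd).2
    · intro O
      have hb : 2 * f Z = expect D (fun _ _ => 2 * f Z) := by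
        have := hD.total
        simp only [expect, mul_one] at this ⊢
        rw [List.sum_map_mul_right, this, one_mul]
      rw [hb]
      refine expect_mono fun d hd => ⟨hD.nonneg d hd, ?_⟩
      have hXY : d.2.2 = d.2.1 := by
        refine Finset.Subset.antisymm (fun v hv => ?_) (hD.sub d hd).1
        by_contra hv'
        simpa using (hD.undecided d hd v).2 ⟨hv, hv'⟩
      have hdL : d.2.1 ∈ L := List.mem_map.2 ⟨d, hd, rfl⟩
      have hle : g d.2.1 ≤ g Z := List.le_of_mem_argmax hdL hZ
      rw [hgf _ hdL, hgf _ hZL] at hle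
      have e : (O ∪ d.2.1) ∩ d.2.2 = d.2.1 := by
        rw [hXY]; exact Finset.inter_eq_right.2 Finset.subset_union_right
      rw [e, hXY]
      linarith
  | cons u l ih =>
    rw [List.nodup_cons] at hl
    simp only [doubleGreedy, OracleProg.run_bind, OracleProg.queries_bind, queries_queryValues,
      length_greedySets]
    set g := (queryValues (greedySets u D)).run f with hg
    have hgf : ∀ T ∈ greedySets u D, g T = f T := run_queryValues f _
    have hsucc : IsGreedySucc u D g (greedySucc u D g) := by
      have hex : ∃ D', IsGreedySucc u D g D' := by
        refine exists_isGreedySucc u D g hD.nonneg fun d hd => ?_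
        have hm : ∀ T ∈ [d.2.1, insert u d.2.1, d.2.2, d.2.2.erase u], g T = f T :=
          fun T hT => hgf T (List.mem_flatMap.2 ⟨d, hd, hT⟩)
        rw [hm _ (by simp), hm _ (by simp), hm d.2.2 (by simp), hm (d.2.2.erase u) (by simp)]
        obtain ⟨hu, hu'⟩ := (hD.undecided d hd u).1 (by simp)
        exact hf.marginal_add_nonneg (hD.sub d hd).1 hu hu'
      rw [greedySucc, dif_pos hex]
      exact hex.choose_spec
    obtain ⟨i1, i2, i3⟩ := ih hl.2 _ (hD.succ hl.1 hsucc)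
    refine ⟨i1, fun O => (hsucc.potential_le hf hD hgf O).trans (i2 O), ?_⟩
    have hlen := hsucc.length_le
    rw [List.length_cons]
    calc _ ≤ 4 * D.length + (4 * (D.length + 2) * l.length + 4 * l.length ^ 2 +
          (D.length + 2)) := by gcongr; exact i3.trans (by gcongr)
      _ ≤ _ := by ring_nf; omega

theorem exists_isHalfUSM : ∃ (c : ℕ) (U : (n : ℕ) → Finset (Fin n) →
    OracleProg n (Finset (Fin n))), IsHalfUSM c U := by
  refine ⟨8, fun n S => doubleGreedy S.toList [(1, ∅, S)], fun n f hf0 hf S => ?_⟩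
  obtain ⟨h1, h2, h3⟩ := doubleGreedy_spec hf S S.toList S.nodup_toList [(1, ∅, S)]
    ⟨by simp, by simp, by simp, by simp [expect]⟩
  refine ⟨h1, fun T hT => ?_, h3.trans ?_⟩
  -- From the point mass at `(∅, S)` the potential starts at `f T + (f ∅ + f S) / 2`, which is at
  -- least `f T`.
  · have h := h2 T
    simp only [expect, List.map_cons, List.map_nil, List.sum_cons, List.sum_nil,
      Finset.union_empty, Finset.inter_eq_left.2 hT] at h
    linarith [hf0 ∅, hf0 S]
  · simp only [List.length_singleton, Finset.length_toList]
    nlinarith [Nat.le_self_pow (two_ne_zero) S.card]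


/-! ### Linear packing constraints -/

/-- The load of `S` on constraint `i`. -/
def load {m n : ℕ} (A : Matrix (Fin m) (Fin n) ℝ) (S : Finset (Fin n)) (i : Fin m) : ℝ :=
  ∑ j ∈ S, A i j

theorem feasible_iff {m n : ℕ} (A : Matrix (Fin m) (Fin n) ℝ) (b : Fin m → ℝ)
    (S : Finset (Fin n)) : Feasible A b S ↔ ∀ i, load A S i ≤ b i := by
  simp [Feasible, Pi.le_def, Matrix.mulVec, dotProduct, load]

theorem Feasible.mono {m n : ℕ} {A : Matrix (Fin m) (Fin n) ℝ} {b : Fin m → ℝ}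
    (hA : ∀ i j, 0 ≤ A i j) {S T : Finset (Fin n)} (hT : Feasible A b T) (hST : S ⊆ T) :
    Feasible A b S := by
  rw [feasible_iff] at *
  exact fun i => (Finset.sum_le_sum_of_subset_of_nonneg hST fun j _ _ => hA i j).trans (hT i)

theorem width_mul_le {m n : ℕ} {A : Matrix (Fin m) (Fin n) ℝ} {b : Fin m → ℝ}
    (hA : ∀ i j, 0 ≤ A i j) (hb : ∀ i, 0 < b i) (i : Fin m) (j : Fin n) :
    width A b * A i j ≤ b i := by
  rcases (hA i j).eq_or_lt with h | h
  · rw [← h, mul_zero]; exact (hb i).le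
  · rw [← le_div_iff₀ h]
    refine csInf_le ⟨0, ?_⟩ ⟨i, j, h, rfl⟩
    rintro r ⟨i, j, h, rfl⟩
    exact (div_pos (hb i) h).le

/-! ### Ratios -/

/-- Cross-multiplication of the greedy comparison that survives zero costs: a finite ratio can
dominate `g' / 0` only if `g' ≤ 0`. -/
theorem gain_mul_le_of_ratio_le {g c g' c' : ℝ} (hc : 0 ≤ c) (hc' : 0 ≤ c') (hg : 0 < g)
    (h : ratio g' c' ≤ ratio g c) : g' * c ≤ g * c' := by
  rcases hc.eq_or_lt with rfl | hc
  · rw [mul_zero]; positivity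
  rcases hc'.eq_or_lt with rfl | hc'
  · rw [ratio, if_pos rfl, ratio, if_neg hc.ne'] at h
    have : g' ≤ 0 := by
      by_contra hp
      rw [EReal.coe_mul_top_of_pos (not_le.1 hp)] at h
      exact absurd h (not_le.2 (EReal.coe_lt_top _))
    rw [mul_zero]
    exact mul_nonpos_of_nonpos_of_nonneg this hc.le
  · rw [ratio, if_neg hc'.ne', ratio, if_neg hc.ne', EReal.coe_le_coe_iff,
      div_le_div_iff₀ hc' hc] at h
    exact h

/-- A ratio has the sign of its gain, so leaving the loop at a maximizer without gain certifies that
no remaining element has any. -/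
theorem gain_nonpos_of_ratio_le {g c g' c' : ℝ} (hc : 0 ≤ c) (hc' : 0 ≤ c') (hg : g ≤ 0)
    (h : ratio g' c' ≤ ratio g c) : g' ≤ 0 := by
  have h0 : ratio g c ≤ 0 := by
    rw [ratio]
    split_ifs
    · exact EReal.mul_nonpos_iff.2 (Or.inr ⟨by exact_mod_cast hg, le_top⟩)
    · exact_mod_cast div_nonpos_of_nonpos_of_nonneg hg hc
  have h1 := h.trans h0
  by_contra hp
  push Not at hp
  rw [ratio] at h1
  split_ifs at h1 with h2
  · rw [EReal.coe_mul_top_of_pos hp] at h1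
    exact absurd h1 (not_le.2 EReal.zero_lt_top)
  · have h3 : g' / c' ≤ 0 := by exact_mod_cast h1
    exact absurd h3 (not_le.2 (div_pos hp (lt_of_le_of_ne hc' (Ne.symm h2))))

theorem tieBreak_spec {n : ℕ} {tb : Finset (Fin n) → Fin n}
    (htb : ∀ R : Finset (Fin n), R.Nonempty → tb R ∈ R) {R : Finset (Fin n)} (hR : R.Nonempty)
    (r : Fin n → EReal) : tb (argmaxSet R r) ∈ R ∧ ∀ k ∈ R, r k ≤ r (tb (argmaxSet R r)) := by
  have hne : (argmaxSet R r).Nonempty := by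
    obtain ⟨j, hj, hmax⟩ := R.exists_max_image r hR
    exact ⟨j, Finset.mem_filter.2 ⟨hj, hmax⟩⟩
  exact Finset.mem_filter.1 (htb _ hne)

/-! ### The weights of the multiplicative updates algorithm -/

/-- The weights when the current solution is `S` and the update parameter is `exp L`. -/
noncomputable def weight {m n : ℕ} (A : Matrix (Fin m) (Fin n) ℝ) (b : Fin m → ℝ) (L : ℝ)
    (S : Finset (Fin n)) (i : Fin m) : ℝ :=
  1 / b i * Real.exp (L * (load A S i / b i))

/-- The potential `∑ i, b i * w i`. -/
noncomputable def totalWeight {m n : ℕ} (A : Matrix (Fin m) (Fin n) ℝ) (b : Fin m → ℝ) (L : ℝ)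
    (S : Finset (Fin n)) : ℝ :=
  ∑ i, b i * weight A b L S i

/-- The cost of element `j` when the current solution is `S`. -/
noncomputable def cost {m n : ℕ} (A : Matrix (Fin m) (Fin n) ℝ) (b : Fin m → ℝ) (L : ℝ)
    (S : Finset (Fin n)) (j : Fin n) : ℝ :=
  ∑ i, A i j * weight A b L S i

section Weights

variable {m n : ℕ} {A : Matrix (Fin m) (Fin n) ℝ} {b : Fin m → ℝ} {L : ℝ}

theorem weight_empty (i : Fin m) : weight A b L ∅ i = 1 / b i := by
  simp [weight, load]

theorem weight_pos (hb : ∀ i, 0 < b i) (S : Finset (Fin n)) (i : Fin m) :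
    0 < weight A b L S i :=
  mul_pos (one_div_pos.2 (hb i)) (Real.exp_pos _)

theorem mul_weight (hb : ∀ i, 0 < b i) (S : Finset (Fin n)) (i : Fin m) :
    b i * weight A b L S i = Real.exp (L * (load A S i / b i)) := by
  rw [weight, ← mul_assoc, mul_one_div_cancel (hb i).ne', one_mul]

/-- The multiplicative update of the loop preserves the closed form of the weights. -/
theorem weight_insert {S : Finset (Fin n)} {j : Fin n} (hj : j ∉ S) (i : Fin m) :
    weight A b L (insert j S) i = weight A b L S i * Real.exp L ^ (A i j / b i) := by
  rw [weight, weight, ← Real.exp_mul, mul_assoc, ← Real.exp_add, load, Finset.sum_insert hj, load]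
  ring_nf

theorem cost_nonneg (hA : ∀ i j, 0 ≤ A i j) (hb : ∀ i, 0 < b i) (S : Finset (Fin n)) (j : Fin n) :
    0 ≤ cost A b L S j :=
  Finset.sum_nonneg fun i _ => mul_nonneg (hA i j) (weight_pos hb S i).le

theorem totalWeight_empty (hb : ∀ i, 0 < b i) : totalWeight A b L ∅ = m := by
  simp [totalWeight, mul_weight hb, load]

theorem totalWeight_pos [Nonempty (Fin m)] (hb : ∀ i, 0 < b i) (S : Finset (Fin n)) :
    0 < totalWeight A b L S :=
  Finset.sum_pos (fun i _ => mul_pos (hb i) (weight_pos hb S i)) Finset.univ_nonempty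

theorem exp_le_totalWeight (hb : ∀ i, 0 < b i) (S : Finset (Fin n)) (i : Fin m) :
    Real.exp (L * (load A S i / b i)) ≤ totalWeight A b L S := by
  rw [← mul_weight hb]
  exact Finset.single_le_sum (f := fun i => b i * weight A b L S i)
    (fun i _ => mul_nonneg (hb i).le (weight_pos hb S i).le) (Finset.mem_univ i)

/-- Exchanging the sums turns the total cost into `∑ load_i(C) w_i`; this is where feasibility of
the competitor enters. -/
theorem sum_cost_le (hb : ∀ i, 0 < b i) (S : Finset (Fin n)) {C : Finset (Fin n)}
    (hC : Feasible A b C) : ∑ k ∈ C, cost A b L S k ≤ totalWeight A b L S := by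
  rw [feasible_iff] at hC
  simp only [cost]
  rw [Finset.sum_comm]
  refine Finset.sum_le_sum fun i _ => ?_
  rw [← Finset.sum_mul]
  exact mul_le_mul_of_nonneg_right (hC i) (weight_pos hb S i).le

/-- The sharp estimate, giving `κ = 1 + δ` for the approximation ratio. -/
theorem exp_le_one_add_mul {x δ : ℝ} (hx : 0 ≤ x) (hxδ : x ≤ δ) (hδ : δ ≤ 1) :
    Real.exp x ≤ 1 + x * (1 + δ) := by
  have h := Real.abs_exp_sub_one_sub_id_le (x := x) (by rw [abs_of_nonneg hx]; linarith)
  have h' := (abs_le.1 h).2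
  nlinarith

/-- From `e^x (1 - x) ≤ 1`. It is cruder but free of any upper bound on `δ`, so feasibility is
covered for every `ε`. -/
theorem exp_le_one_add_mul_exp {x δ : ℝ} (hx : 0 ≤ x) (hxδ : x ≤ δ) :
    Real.exp x ≤ 1 + x * Real.exp δ := by
  have h1 := Real.add_one_le_exp (-x)
  have h2 := mul_le_mul_of_nonneg_left h1 (Real.exp_pos x).le
  rw [← Real.exp_add, add_neg_cancel, Real.exp_zero] at h2
  have h3 := mul_le_mul_of_nonneg_left (Real.exp_le_exp.2 hxδ) hx
  linarith

theorem log_totalWeight_insert_le [Nonempty (Fin m)] {κ : ℝ} (hb : ∀ i, 0 < b i)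
    (hκ : ∀ i j, Real.exp (L * (A i j / b i)) ≤ 1 + L * (A i j / b i) * κ)
    {S : Finset (Fin n)} {j : Fin n} (hj : j ∉ S) :
    Real.log (totalWeight A b L (insert j S)) ≤
      Real.log (totalWeight A b L S) +
        L * κ * cost A b L S j / totalWeight A b L S := by
  have hpos := totalWeight_pos (A := A) (L := L) hb S
  have hstep : totalWeight A b L (insert j S) ≤
      totalWeight A b L S + L * κ * cost A b L S j := by
    rw [cost, Finset.mul_sum, totalWeight, totalWeight, ← Finset.sum_add_distrib]
    refine Finset.sum_le_sum fun i _ => ?_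
    rw [weight_insert hj, ← Real.exp_mul]
    have h := hκ i j
    have hw := weight_pos (A := A) (L := L) hb S i
    calc b i * (weight A b L S i * Real.exp (L * (A i j / b i)))
        ≤ b i * (weight A b L S i * (1 + L * (A i j / b i) * κ)) :=
          mul_le_mul_of_nonneg_left (mul_le_mul_of_nonneg_left h hw.le) (hb i).le
      _ = _ := by
          have := (hb i).ne'
          field_simp
  have h0 : 0 < totalWeight A b L S + L * κ * cost A b L S j :=
    (totalWeight_pos hb _).trans_le hstep
  have e : 1 + L * κ * cost A b L S j / totalWeight A b L S =
      (totalWeight A b L S + L * κ * cost A b L S j) / totalWeight A b L S := by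
    field_simp
  have h1 : 0 < 1 + L * κ * cost A b L S j / totalWeight A b L S := by
    rw [e]; positivity
  calc Real.log (totalWeight A b L (insert j S))
      ≤ Real.log (totalWeight A b L S + L * κ * cost A b L S j) :=
        Real.log_le_log (totalWeight_pos hb _) hstep
    _ = Real.log (totalWeight A b L S) +
        Real.log (1 + L * κ * cost A b L S j / totalWeight A b L S) := by
        rw [e, Real.log_div h0.ne' hpos.ne']
        ring
    _ ≤ _ := by linarith [Real.log_le_sub_one_of_pos h1]

end Weights

/-! ### The loop of multiplicative updates -/

theorem run_queryTable {n : ℕ} (f : Finset (Fin n) → ℝ) (S : Finset (Fin n)) (l : List (Fin n)) :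
    ∀ j ∈ l, (queryTable S l).run f j = f (insert j S) := by
  induction l with
  | nil => simp
  | cons k l ih =>
    intro j hj
    simp only [queryTable, OracleProg.run_query, OracleProg.run_bind, OracleProg.run_pure]
    by_cases h : j = k
    · subst h; simp
    · rw [Function.update_of_ne h]
      exact ih j (by simpa [h] using hj)

theorem queries_queryTable {n : ℕ} (f : Finset (Fin n) → ℝ) (S : Finset (Fin n))
    (l : List (Fin n)) : (queryTable S l).queries f = l.length := by
  induction l with
  | nil => rfl
  | cons T l ih => simp [queryTable, ih]

/-- The guarantee collected by the loop when the current solution is `S`. -/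
def HasGuarantee {m n : ℕ} (A : Matrix (Fin m) (Fin n) ℝ) (b : Fin m → ℝ) (L κ : ℝ)
    (f : Finset (Fin n) → ℝ) (N S : Finset (Fin n)) : Prop :=
  ∀ T C : Finset (Fin n), S ⊆ T → C ⊆ N → Feasible A b C → 0 ≤ f (T ∪ C) - f T →
    (f (T ∪ C) - f T) * (Real.log (totalWeight A b L S) - Real.log m) ≤ L * κ * f S

/-- The competitor's gain is measured at a fixed superset `T`, so that it stays constant while `S`
grows; marginals at `T` are bounded by those at `S`. The final set is substituted for `T` only at
the end. -/
theorem HasGuarantee.insert {m n : ℕ} [Nonempty (Fin m)] {A : Matrix (Fin m) (Fin n) ℝ}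
    {b : Fin m → ℝ} {L κ : ℝ} {f : Finset (Fin n) → ℝ} {N S : Finset (Fin n)} {j : Fin n}
    (hA : ∀ i j, 0 ≤ A i j) (hb : ∀ i, 0 < b i) (hL : 0 ≤ L) (hκ0 : 0 ≤ κ)
    (hκ : ∀ i j, Real.exp (L * (A i j / b i)) ≤ 1 + L * (A i j / b i) * κ)
    (hf : Submodular f)
    (h : HasGuarantee A b L κ f N S) (hj : j ∉ S) (hgain : 0 < f (insert j S) - f S)
    (hmax : ∀ k ∈ N \ S, ratio (f (insert k S) - f S) (cost A b L S k) ≤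
      ratio (f (insert j S) - f S) (cost A b L S j)) :
    HasGuarantee A b L κ f N (insert j S) := by
  intro T C hST hCN hC hΔ
  have hST' : S ⊆ T := (Finset.subset_insert j S).trans hST
  have h1 := h T C hST' hCN hC hΔ
  have hpos := totalWeight_pos (A := A) (L := L) hb S
  have hlog := log_totalWeight_insert_le hb hκ hj
  set Δ := f (T ∪ C) - f T with hΔdef
  set c := cost A b L S j with hc
  set g := f (Insert.insert j S) - f S with hg
  set β := totalWeight A b L S with hβ
  have hc0 : 0 ≤ c := cost_nonneg hA hb S j
  have key : Δ * c ≤ g * β := by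
    calc Δ * c ≤ (∑ k ∈ C \ T, (f (Insert.insert k S) - f S)) * c := by
          refine mul_le_mul_of_nonneg_right ((hf.union_sub_le_sum T C).trans ?_) hc0
          exact Finset.sum_le_sum fun k hk =>
            hf.marginal_anti hST' (Finset.mem_sdiff.1 hk).2
      _ ≤ ∑ k ∈ C \ T, g * cost A b L S k := by
          rw [Finset.sum_mul]
          refine Finset.sum_le_sum fun k hk => ?_
          have hk' := Finset.mem_sdiff.1 hk
          exact gain_mul_le_of_ratio_le hc0 (cost_nonneg hA hb S k) hgain
            (hmax k (Finset.mem_sdiff.2 ⟨hCN hk'.1, fun h => hk'.2 (hST' h)⟩))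
      _ ≤ ∑ k ∈ C, g * cost A b L S k :=
          Finset.sum_le_sum_of_subset_of_nonneg Finset.sdiff_subset fun k _ _ =>
            mul_nonneg hgain.le (cost_nonneg hA hb S k)
      _ ≤ g * β := by
          rw [← Finset.mul_sum]
          exact mul_le_mul_of_nonneg_left (sum_cost_le hb S hC) hgain.le
  have key' : Δ * (c / β) ≤ g := by
    rw [← mul_div_assoc, div_le_iff₀ hpos]; exact key
  have hK : 0 ≤ L * κ := by positivity
  have e : L * κ * c / β = L * κ * (c / β) := by ring
  rw [e] at hlog
  have h2 := mul_le_mul_of_nonneg_left hlog hΔ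
  have h3 := mul_le_mul_of_nonneg_left key' hK
  linarith

/-- What holds when the loop ends with solution `p.1` and last added element `p.2`. -/
structure IsLoopResult {m n : ℕ} (A : Matrix (Fin m) (Fin n) ℝ) (b : Fin m → ℝ) (L κ : ℝ)
    (f : Finset (Fin n) → ℝ) (N : Finset (Fin n)) (p : Finset (Fin n) × Option (Fin n)) :
    Prop where
  subset : p.1 ⊆ N
  guarantee : HasGuarantee A b L κ f N p.1
  last_none : p.2 = none → p.1 = ∅
  last_some : ∀ j, p.2 = some j → j ∈ p.1 ∧ HasGuarantee A b L κ f N (p.1.erase j) ∧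
    totalWeight A b L (p.1.erase j) ≤ Real.exp L
  finished : Real.exp L < totalWeight A b L p.1 ∨ ∀ k ∈ N \ p.1, f (insert k p.1) ≤ f p.1

/-- Induction on the round budget, which always covers `N \ S`; when it runs out no element is left,
so the second alternative of `finished` holds vacuously. -/
theorem isLoopResult_muLoop {m n : ℕ} [Nonempty (Fin m)] {A : Matrix (Fin m) (Fin n) ℝ}
    {b : Fin m → ℝ} {L κ : ℝ} {f : Finset (Fin n) → ℝ} {N : Finset (Fin n)}
    {tb : Finset (Fin n) → Fin n} (htb : ∀ R : Finset (Fin n), R.Nonempty → tb R ∈ R)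
    (hA : ∀ i j, 0 ≤ A i j) (hb : ∀ i, 0 < b i) (hL : 0 ≤ L) (hκ0 : 0 ≤ κ)
    (hκ : ∀ i j, Real.exp (L * (A i j / b i)) ≤ 1 + L * (A i j / b i) * κ)
    (hf : Submodular f) (k : ℕ) (S : Finset (Fin n))
    (last : Option (Fin n)) (hk : (N \ S).card ≤ k) (hSN : S ⊆ N)
    (hS : HasGuarantee A b L κ f N S) (hnone : last = none → S = ∅)
    (hsome : ∀ j, last = some j → j ∈ S ∧ HasGuarantee A b L κ f N (S.erase j) ∧
      totalWeight A b L (S.erase j) ≤ Real.exp L) :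
    IsLoopResult A b L κ f N ((muLoop tb A b (Real.exp L) N k S last (weight A b L S)).run f) := by
  induction k generalizing S last with
  | zero =>
    refine ⟨hSN, hS, hnone, hsome, Or.inr fun k hk' => ?_⟩
    rw [Nat.le_zero, Finset.card_eq_zero] at hk
    simp only [muLoop, OracleProg.run_pure, hk, Finset.notMem_empty] at hk'
  | succ k ih =>
    rw [muLoop]
    split_ifs with hcond
    · obtain ⟨hw, hne⟩ := hcond
      simp only [OracleProg.run_query, OracleProg.run_bind]
      set g := (queryTable S (N \ S).sort).run f with hg
      have hgf : ∀ j ∈ N \ S, g j = f (insert j S) := fun j hj =>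
        run_queryTable f S _ j ((Finset.mem_sort _).2 hj)
      obtain ⟨hjmem, hjmax⟩ := tieBreak_spec htb hne
        (fun j => ratio (g j - f S) (∑ i, A i j * weight A b L S i))
      set j := tb (argmaxSet (N \ S)
        (fun j => ratio (g j - f S) (∑ i, A i j * weight A b L S i))) with hj
      have hmax : ∀ k ∈ N \ S, ratio (f (insert k S) - f S) (cost A b L S k) ≤
          ratio (f (insert j S) - f S) (cost A b L S j) := by
        intro k hk
        have := hjmax k hk
        rwa [hgf k hk, hgf j hjmem] at this
      obtain ⟨hjN, hjS⟩ := Finset.mem_sdiff.1 hjmem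
      split_ifs with hgain
      · rw [hgf j hjmem] at hgain
        refine ⟨hSN, hS, hnone, hsome, Or.inr fun k hk => ?_⟩
        have := gain_nonpos_of_ratio_le (cost_nonneg hA hb S j) (cost_nonneg hA hb S k) hgain
          (hmax k hk)
        simpa using this
      · rw [hgf j hjmem, not_le] at hgain
        have hweight : (fun i => weight A b L S i * Real.exp L ^ (A i j / b i)) =
            weight A b L (insert j S) := funext fun i => (weight_insert hjS i).symm
        rw [hweight]
        refine ih (insert j S) (some j) ?_ (Finset.insert_subset hjN hSN)
          (hS.insert hA hb hL hκ0 hκ hf hjS hgain hmax) (by simp) ?_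
        · rw [Finset.sdiff_insert, Finset.card_erase_of_mem hjmem]
          omega
        · rintro _ ⟨⟩
          -- Erasing the last element recovers the previous set, which had passed the loop test.
          rw [Finset.erase_insert hjS]
          exact ⟨Finset.mem_insert_self _ _, hS, hw⟩
    · refine ⟨hSN, hS, hnone, hsome, ?_⟩
      rw [not_and_or, not_le, Finset.not_nonempty_iff_eq_empty] at hcond
      rcases hcond with h | h
      · exact Or.inl h
      · refine Or.inr fun k hk' => ?_
        simp only [OracleProg.run_pure, h, Finset.notMem_empty] at hk'

theorem queries_muLoop_le {m n : ℕ} (tb : Finset (Fin n) → Fin n) (A : Matrix (Fin m) (Fin n) ℝ)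
    (b : Fin m → ℝ) (lam : ℝ) (N : Finset (Fin n)) (f : Finset (Fin n) → ℝ) (k : ℕ)
    (S : Finset (Fin n)) (last : Option (Fin n)) (w : Fin m → ℝ) :
    (muLoop tb A b lam N k S last w).queries f ≤ k * (n + 1) := by
  induction k generalizing S last w with
  | zero => simp [muLoop]
  | succ k ih =>
    have hcard : (N \ S).card ≤ n := by simpa using Finset.card_le_univ (N \ S)
    rw [muLoop]
    split_ifs
    · simp only [OracleProg.queries_query, OracleProg.queries_bind, queries_queryTable,
        Finset.length_sort]
      split_ifs
      · simp only [OracleProg.queries_pure]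
        nlinarith
      · have := ih (insert (tb (argmaxSet (N \ S) fun j =>
          ratio ((queryTable S (N \ S).sort).run f j - f S) (∑ i, A i j * w i))) S)
          (some (tb (argmaxSet (N \ S) fun j =>
          ratio ((queryTable S (N \ S).sort).run f j - f S) (∑ i, A i j * w i))))
          (fun i => w i * lam ^ (A i (tb (argmaxSet (N \ S) fun j =>
          ratio ((queryTable S (N \ S).sort).run f j - f S) (∑ i, A i j * w i))) / b i))
        nlinarith
    · simp

theorem queries_multUpdates_le {m n : ℕ} (tb : Finset (Fin n) → Fin n)
    (A : Matrix (Fin m) (Fin n) ℝ) (b : Fin m → ℝ) (lam : ℝ) (N : Finset (Fin n))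
    (f : Finset (Fin n) → ℝ) : (multUpdates tb A b lam N).queries f ≤ n * (n + 1) := by
  simp only [multUpdates, OracleProg.queries_bind, OracleProg.queries_pure, add_zero]
  exact (queries_muLoop_le _ _ _ _ _ _ _ _ _ _).trans
    (Nat.mul_le_mul_right _ (by simpa using Finset.card_le_univ N))

/-- The set returned by multiplicative updates is feasible, and unless no element of `N` improves
on it, it satisfies the guarantee with a total weight close to `exp L`. -/
theorem multUpdates_spec {m n : ℕ} [Nonempty (Fin m)] {A : Matrix (Fin m) (Fin n) ℝ}
    {b : Fin m → ℝ} {L δ κ : ℝ} {f : Finset (Fin n) → ℝ} (N : Finset (Fin n))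
    {tb : Finset (Fin n) → Fin n} (htb : ∀ R : Finset (Fin n), R.Nonempty → tb R ∈ R)
    (hA : ∀ i j, 0 ≤ A i j) (hb : ∀ i, 0 < b i) (hL : 0 < L) (hκ0 : 0 ≤ κ)
    (hκ : ∀ i j, Real.exp (L * (A i j / b i)) ≤ 1 + L * (A i j / b i) * κ) (hδ0 : 0 ≤ δ)
    (hLδ : ∀ i j, L * (A i j / b i) ≤ δ) (hf : Submodular f) (hf0 : ∀ S, 0 ≤ f S) :
    (multUpdates tb A b (Real.exp L) N).run f ⊆ N ∧
    Feasible A b ((multUpdates tb A b (Real.exp L) N).run f) ∧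
    ((∀ C ⊆ N, f ((multUpdates tb A b (Real.exp L) N).run f ∪ C) ≤
        f ((multUpdates tb A b (Real.exp L) N).run f)) ∨
      (HasGuarantee A b L κ f N ((multUpdates tb A b (Real.exp L) N).run f) ∧
        Real.exp (L - δ) ≤
          totalWeight A b L ((multUpdates tb A b (Real.exp L) N).run f))) := by
  have hempty : HasGuarantee A b L κ f N ∅ := by
    intro T C _ _ _ _
    rw [totalWeight_empty hb, sub_self, mul_zero]
    have := hf0 ∅
    positivity
  have hres := isLoopResult_muLoop (last := none) htb hA hb hL.le hκ0 hκ hf N.card ∅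
    (by simp) (Finset.empty_subset N) hempty (fun _ => rfl) (by simp)
  have hw : weight A b L (∅ : Finset (Fin n)) = fun i => 1 / b i := funext fun i => weight_empty i
  rw [hw] at hres
  simp only [multUpdates, OracleProg.run_bind, OracleProg.run_pure]
  generalize (muLoop tb A b (Real.exp L) N N.card ∅ none (fun i => 1 / b i)).run f = p at *
  obtain ⟨S, last⟩ := p
  obtain ⟨hSN, hS, hnone, hsome, hfinished⟩ := hres
  dsimp only at *
  split_ifs with hfeas
  · refine ⟨hSN, hfeas, ?_⟩
    rcases hfinished with h | h
    · exact Or.inr ⟨hS, (Real.exp_le_exp.2 (by linarith)).trans h.le⟩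
    · refine Or.inl fun C hC => ?_
      have h1 := hf.union_sub_le_sum S C
      have h2 : ∑ k ∈ C \ S, (f (insert k S) - f S) ≤ 0 :=
        Finset.sum_nonpos fun k hk =>
          sub_nonpos.2 (h k (Finset.sdiff_subset_sdiff hC subset_rfl hk))
      linarith
  · cases last with
    | none =>
      rw [hnone rfl, feasible_iff] at hfeas
      exact absurd (fun i => by simpa [load] using (hb i).le) hfeas
    | some j =>
      obtain ⟨hjS, hG, hle⟩ := hsome j rfl
      refine ⟨(Finset.erase_subset _ _).trans hSN, ?_, Or.inr ⟨hG, ?_⟩⟩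
      -- The set before the last addition had potential at most `exp L`, so each single term forces
      -- `load_i ≤ b_i`.
      · rw [feasible_iff]
        intro i
        have h := (exp_le_totalWeight (A := A) (L := L) hb (S.erase j) i).trans hle
        rw [Real.exp_le_exp] at h
        have h' : load A (S.erase j) i / b i ≤ 1 := by
          by_contra hlt
          nlinarith [not_le.1 hlt]
        rwa [div_le_one (hb i)] at h'
      -- A constraint violated with `j` loses at most `δ` in its exponent when `j` is dropped, so
      -- the potential stays above `exp (L - δ)`.
      · rw [feasible_iff] at hfeas
        push Not at hfeas
        obtain ⟨i, hi⟩ := hfeas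
        refine le_trans (Real.exp_le_exp.2 ?_) (exp_le_totalWeight hb _ i)
        have e : load A (S.erase j) i = load A S i - A i j := by
          rw [load, load, ← Finset.sum_erase_add _ _ hjS]; ring
        rw [e, sub_div, mul_sub]
        have h1 : 1 ≤ load A S i / b i := (one_le_div (hb i)).2 hi.le
        have h2 := hLδ i j
        nlinarith

theorem multUpdates_approx {m n : ℕ} [Nonempty (Fin m)] {A : Matrix (Fin m) (Fin n) ℝ}
    {b : Fin m → ℝ} {L δ : ℝ} {f : Finset (Fin n) → ℝ} (N : Finset (Fin n))
    {tb : Finset (Fin n) → Fin n} (htb : ∀ R : Finset (Fin n), R.Nonempty → tb R ∈ R)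
    (hA : ∀ i j, 0 ≤ A i j) (hb : ∀ i, 0 < b i) (hL : 0 < L) (hδ0 : 0 ≤ δ) (hδ : δ ≤ 1 / 2)
    (hLδ : ∀ i j, L * (A i j / b i) ≤ δ) (hf : Submodular f) (hf0 : ∀ S, 0 ≤ f S)
    (hm : Real.log m ≤ δ * L) (hL1 : 1 ≤ L) {C : Finset (Fin n)} (hCN : C ⊆ N)
    (hC : Feasible A b C) :
    (1 - 2 * δ) * f ((multUpdates tb A b (Real.exp L) N).run f ∪ C) ≤
      (2 - δ) * f ((multUpdates tb A b (Real.exp L) N).run f) := by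
  obtain ⟨-, -, h⟩ := multUpdates_spec (κ := 1 + δ) N htb hA hb hL (by linarith)
    (fun i j => exp_le_one_add_mul (mul_nonneg hL.le (div_nonneg (hA i j) (hb i).le)) (hLδ i j)
      (by linarith)) hδ0 hLδ hf hf0
  generalize (multUpdates tb A b (Real.exp L) N).run f = S at *
  have h0 := hf0 S
  by_cases hΔ : f (S ∪ C) - f S ≤ 0
  · nlinarith
  rw [not_le] at hΔ
  rcases h with h | ⟨hG, hw⟩
  · linarith [h C hCN]
  have h1 := hG S C subset_rfl hCN hC hΔ.le
  have h2 : L - δ ≤ Real.log (totalWeight A b L S) := by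
    rw [← Real.log_exp (L - δ)]
    exact Real.log_le_log (Real.exp_pos _) hw
  -- `δ ≤ δ L` because `1 ≤ L`, and `log m ≤ δ L`: together they cost `2 δ L`.
  have h3 : (1 - 2 * δ) * L ≤ Real.log (totalWeight A b L S) - Real.log m := by nlinarith
  have h4 := (mul_le_mul_of_nonneg_left h3 hΔ.le).trans h1
  have h5 : (f (S ∪ C) - f S) * (1 - 2 * δ) ≤ (1 + δ) * f S := by
    refine le_of_mul_le_mul_left ?_ hL
    linarith
  linarith

/-! ### The main algorithm -/

theorem bestOfThree_spec {n : ℕ} (f : Finset (Fin n) → ℝ) (S₁ S₂ S₃ : Finset (Fin n)) :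
    ((bestOfThree S₁ S₂ S₃).run f = S₁ ∨ (bestOfThree S₁ S₂ S₃).run f = S₂ ∨
      (bestOfThree S₁ S₂ S₃).run f = S₃) ∧
    f S₁ ≤ f ((bestOfThree S₁ S₂ S₃).run f) ∧ f S₂ ≤ f ((bestOfThree S₁ S₂ S₃).run f) ∧
    f S₃ ≤ f ((bestOfThree S₁ S₂ S₃).run f) := by
  simp only [bestOfThree, OracleProg.run_query, OracleProg.run_pure]
  split_ifs with h1 h2
  · exact ⟨Or.inl rfl, le_rfl, h1.1, h1.2⟩
  · refine ⟨Or.inr (Or.inl rfl), ?_, le_rfl, h2⟩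
    by_contra h
    exact h1 ⟨(not_le.1 h).le, h2.trans (not_le.1 h).le⟩
  · refine ⟨Or.inr (Or.inr rfl), ?_, (not_le.1 h2).le, le_rfl⟩
    by_contra h
    exact h1 ⟨(not_le.1 h2).le.trans (not_le.1 h).le, (not_le.1 h).le⟩

/-- Disjointness makes the intersection of `S₁ ∪ C` and `S₂ ∪ (C \ S₁)` exactly `C \ S₁`.
Nonnegativity discards the union, and a second use of submodularity splits `C` along `S₁`. -/
theorem Submodular.le_add_add {n : ℕ} {f : Finset (Fin n) → ℝ} (hf : Submodular f)
    (hf0 : ∀ S, 0 ≤ f S) {S₁ S₂ : Finset (Fin n)} (hS : S₂ ⊆ Finset.univ \ S₁)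
    (C : Finset (Fin n)) :
    f C ≤ f (S₁ ∪ C) + f (S₂ ∪ (C \ S₁)) + f (C ∩ S₁) := by
  have h1 := hf (S₁ ∪ C) (S₂ ∪ (C \ S₁))
  have h2 := hf (C \ S₁) (C ∩ S₁)
  have e1 : (S₁ ∪ C) ∩ (S₂ ∪ (C \ S₁)) = C \ S₁ := by
    ext x
    have := @hS x
    simp only [Finset.mem_sdiff, Finset.mem_univ, true_and] at this
    simp only [Finset.mem_inter, Finset.mem_union, Finset.mem_sdiff]
    tauto
  have e2 : C \ S₁ ∪ C ∩ S₁ = C := Finset.sdiff_union_inter C S₁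
  rw [e1] at h1
  rw [e2] at h2
  linarith [hf0 (S₁ ∪ C ∪ (S₂ ∪ C \ S₁)), hf0 (C \ S₁ ∩ (C ∩ S₁))]

theorem mainAlg_spec {m n c : ℕ}
    {U : (n : ℕ) → Finset (Fin n) → OracleProg n (Finset (Fin n))} (hU : IsHalfUSM c U)
    {A : Matrix (Fin m) (Fin n) ℝ} {b : Fin m → ℝ} {f : Finset (Fin n) → ℝ} {ε : ℝ}
    {tb : Finset (Fin n) → Fin n} (hA : ∀ i j, 0 ≤ A i j) (hb : ∀ i, 0 < b i)
    (hpos : ∃ i j, 0 < A i j) (hf0 : ∀ S, 0 ≤ f S) (hf : Submodular f)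
    (htb : ∀ R : Finset (Fin n), R.Nonempty → tb R ∈ R) (hε : 0 < ε)
    (hW : max (9 * Real.log m / ε ^ 2) (3 / ε) ≤ width A b) :
    Feasible A b ((mainAlg U tb A b ε).run f) ∧
    (∀ T, Feasible A b T → (1 / 6 - ε) * f T ≤ f ((mainAlg U tb A b ε).run f)) ∧
    (mainAlg U tb A b ε).queries f ≤ (2 * c + 7) * n ^ 2 := by
  obtain ⟨i₀, j₀, -⟩ := hpos
  have : Nonempty (Fin m) := ⟨i₀⟩
  have hn : 1 ≤ n := Nat.one_le_of_lt j₀.2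
  have hW1 : 9 * Real.log m / ε ^ 2 ≤ width A b := (le_max_left _ _).trans hW
  have hW2 : 3 / ε ≤ width A b := (le_max_right _ _).trans hW
  have hW0 : 0 < width A b := (by positivity : (0 : ℝ) < 3 / ε).trans_le hW2
  rw [div_le_iff₀ (by positivity)] at hW1
  rw [div_le_iff₀ hε] at hW2
  have hL : 0 < ε * width A b / 3 := by positivity
  have hLδ : ∀ i j, ε * width A b / 3 * (A i j / b i) ≤ ε / 3 := by
    intro i j
    have h : width A b * A i j / b i ≤ 1 := (div_le_one (hb i)).2 (width_mul_le hA hb i j)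
    calc ε * width A b / 3 * (A i j / b i) = ε / 3 * (width A b * A i j / b i) := by ring
      _ ≤ ε / 3 * 1 := mul_le_mul_of_nonneg_left h (by positivity)
      _ = ε / 3 := mul_one _
  have hspec := fun N => multUpdates_spec (κ := Real.exp (ε / 3)) (f := f) N htb hA hb hL
    (Real.exp_pos _).le (fun i j => exp_le_one_add_mul_exp
      (mul_nonneg hL.le (div_nonneg (hA i j) (hb i).le)) (hLδ i j)) (by positivity) hLδ hf hf0
  have happrox := fun (hε' : ε ≤ 1 / 6) N C hCN hC => multUpdates_approx (f := f) (C := C) N htb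
    hA hb hL (by positivity : 0 ≤ ε / 3) (by linarith) hLδ hf hf0
    (by nlinarith) (by linarith) hCN hC
  simp only [mainAlg, OracleProg.run_bind, OracleProg.queries_bind]
  obtain ⟨-, hfeas₁, -⟩ := hspec Finset.univ
  have hap₁ := fun hε' => happrox hε' Finset.univ
  have hq₁ := queries_multUpdates_le tb A b (Real.exp (ε * width A b / 3)) Finset.univ f
  generalize (multUpdates tb A b (Real.exp (ε * width A b / 3)) Finset.univ).run f = S₁ at *
  obtain ⟨hS₂, hfeas₂, -⟩ := hspec (Finset.univ \ S₁)
  have hap₂ := fun hε' => happrox hε' (Finset.univ \ S₁)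
  have hq₂ := queries_multUpdates_le tb A b (Real.exp (ε * width A b / 3)) (Finset.univ \ S₁) f
  generalize (multUpdates tb A b (Real.exp (ε * width A b / 3)) (Finset.univ \ S₁)).run f = S₂
    at *
  obtain ⟨hS₃, hhalf, hq₃⟩ := hU n f hf0 hf S₁
  generalize (U n S₁).run f = S₃ at *
  obtain ⟨hbest, hle₁, hle₂, hle₃⟩ := bestOfThree_spec f S₁ S₂ S₃
  refine ⟨?_, fun C hC => ?_, ?_⟩
  · rcases hbest with h | h | h <;> rw [h]
    exacts [hfeas₁, hfeas₂, hfeas₁.mono hA hS₃]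
  · generalize f ((bestOfThree S₁ S₂ S₃).run f) = V at *
    have hC0 := hf0 C
    have hV0 := (hf0 S₁).trans hle₁
    -- For larger `ε` the factor `1/6 - ε` is negative and nonnegativity of `f` suffices.
    by_cases hε' : ε ≤ 1 / 6
    · have h1 := hap₁ hε' C (Finset.subset_univ C) hC
      have h2 := hap₂ hε' (C \ S₁) (Finset.sdiff_subset_sdiff (Finset.subset_univ C) subset_rfl)
        (hC.mono hA Finset.sdiff_subset)
      have h3 := hhalf (C ∩ S₁) Finset.inter_subset_right
      have h4 := hf.le_add_add hf0 hS₂ C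
      have hd : 0 < 1 - 2 * (ε / 3) := by linarith
      -- With `δ = ε/3`, the three terms contribute `2 - δ`, `2 - δ` and `2 (1 - 2δ)`, in total `6 -
      -- 6δ = 6 - 2ε`.
      have h5 : (1 - 2 * (ε / 3)) * f C ≤ (6 - 2 * ε) * V := by
        have g1 := mul_le_mul_of_nonneg_left hle₁ (by linarith : 0 ≤ 2 - ε / 3)
        have g2 := mul_le_mul_of_nonneg_left hle₂ (by linarith : 0 ≤ 2 - ε / 3)
        have g3 := mul_le_mul_of_nonneg_left (h3.trans hle₃) hd.le
        have g4 := mul_le_mul_of_nonneg_left h4 hd.le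
        linarith
      have h6 : (1 / 6 - ε) * (6 - 2 * ε) ≤ 1 - 2 * (ε / 3) := by nlinarith
      have h7 := mul_le_mul_of_nonneg_left h5 (by linarith : 0 ≤ 1 / 6 - ε)
      have h8 := mul_le_mul_of_nonneg_right h6 hV0
      refine le_of_mul_le_mul_left ?_ hd
      linarith
    · nlinarith
  · have hcard : S₁.card ≤ n := by simpa using Finset.card_le_univ S₁
    -- The positive entry of `A` gives `1 ≤ n`, which absorbs lower-order terms: `2n(n + 1) + 3 ≤
    -- 7n²` and the subroutine costs at most `2c n²`.
    have h3 : c * (S₁.card ^ 2 + 1) ≤ c * (n ^ 2 + n ^ 2) := by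
      gcongr
      exact Nat.one_le_pow _ _ hn
    have h4 : (bestOfThree S₁ S₂ S₃).queries f = 3 := rfl
    nlinarith

end LinearPacking

theorem mainTheorem3 :
    -- a deterministic 1/2-approximation with quadratically many queries for the
    -- unconstrained problem, as called by the main algorithm, exists
    (∃ (c : ℕ) (U : (n : ℕ) → Finset (Fin n) →
        LinearPacking.OracleProg n (Finset (Fin n))), LinearPacking.IsHalfUSM c U) ∧
    -- and with any such subroutine (and any tie-breaking rule) the main algorithm is a
    -- deterministic (1/6 - ε)-approximation with quadratically many queries
    ∀ c : ℕ, ∃ C : ℕ,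
      ∀ U : (n : ℕ) → Finset (Fin n) → LinearPacking.OracleProg n (Finset (Fin n)),
        LinearPacking.IsHalfUSM c U →
      ∀ (m n : ℕ) (A : Matrix (Fin m) (Fin n) ℝ) (b : Fin m → ℝ)
        (f : Finset (Fin n) → ℝ) (ε : ℝ) (tb : Finset (Fin n) → Fin n),
        (∀ i j, 0 ≤ A i j ∧ A i j ≤ 1) → (∀ i, 1 ≤ b i) → (∃ i j, 0 < A i j) →
        (∀ S, 0 ≤ f S) → LinearPacking.Submodular f →
        (∀ R : Finset (Fin n), R.Nonempty → tb R ∈ R) →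
        0 < ε →
        max (9 * Real.log m / ε ^ 2) (3 / ε) ≤ LinearPacking.width A b →
          LinearPacking.Feasible A b ((LinearPacking.mainAlg U tb A b ε).run f) ∧
          (∀ T, LinearPacking.Feasible A b T →
            (1 / 6 - ε) * f T ≤ f ((LinearPacking.mainAlg U tb A b ε).run f)) ∧
          (LinearPacking.mainAlg U tb A b ε).queries f ≤ C * n ^ 2 := by
  refine ⟨LinearPacking.exists_isHalfUSM, fun c => ⟨2 * c + 7, ?_⟩⟩
  intro U hU m n A b f ε tb hA hb hpos hf0 hf htb hε hW
  exact LinearPacking.mainAlg_spec hU (fun i j => (hA i j).1)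
    (fun i => zero_lt_one.trans_le (hb i)) hpos hf0 hf htb hε hW
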